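/- Let $X$ be a Polish space, let $E$ be a countable Borel equivalence relation on $X$ (that is, $E$ is a Borel subset of $X \times X$ and every $E$-class is countable), and let $\Gamma$ be a countable non-abelian free group (of finite or countably infinite rank). Suppose that $E$ is - compressible: there is a Borel injection $\phi \colon X \to X$, with $x \mathrel{E} \phi(x)$ for all $x \in X$, such that $X \setminus \phi(X)$ intersects every $E$-class; and - treeable: there is an acyclic graph $G$ on $X$ (an irreflexive symmetric subset of $X \times X$ without cycles) which is Borel as a subset of $X \times X$ and for which $E$ is the smallest equivalence relation on $X$ containing $G$. Then there is a free Borel action of $\Gamma$ on $X$ generating $E$, i.e., an action of $\Gamma$ on $X$ such that for each $\gamma \in \Gamma$ the map $x \mapsto \gamma \cdot x$ is Borel, $\gamma \cdot x = x$ for some $x \in X$ only if $\gamma$ is the identity, and for all $x, y \in X$, $x \mathrel{E} y$ if and only if $\gamma \cdot x = y$ for some $\gamma \in \Gamma$. -/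

import Mathlib

namespace BorelEq

/-- A countable Borel equivalence relation: Borel as a subset of `X × X`, with all classes
countable. -/
structure IsCountableBorel {X : Type*} [MeasurableSpace X] (E : Setoid X) : Prop where
  measurableSet : MeasurableSet {p : X × X | E p.1 p.2}
  countable_class : ∀ x : X, {y : X | E x y}.Countable

/-- A graph is a graphing of `E` if `E` is the smallest equivalence relation containing it. -/
def IsGraphing {X : Type*} (G : SimpleGraph X) (E : Setoid X) : Prop :=
  Relation.EqvGen.setoid G.Adj = E

/-- A treeing of `E` is an acyclic graphing of `E`. -/
def IsTreeing {X : Type*} (G : SimpleGraph X) (E : Setoid X) : Prop :=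
  IsGraphing G E ∧ G.IsAcyclic

/-- `E` is treeable if it has a Borel treeing. -/
def IsTreeable {X : Type*} [MeasurableSpace X] (E : Setoid X) : Prop :=
  ∃ G : SimpleGraph X, MeasurableSet {p : X × X | G.Adj p.1 p.2} ∧ IsTreeing G E

/-- `E` is compressible if there is a Borel injection `φ : X → X` whose graph is contained in `E`
and for which the complement of the image of `φ` meets every `E`-class. -/
def IsCompressible {X : Type*} [MeasurableSpace X] (E : Setoid X) : Prop :=
  ∃ φ : X → X, Measurable φ ∧ Function.Injective φ ∧ (∀ x : X, E x (φ x)) ∧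
    ∀ x : X, ∃ y : X, E x y ∧ y ∉ Set.range φ

/-- The countable (discrete) group `Γ` has a free Borel action on `X` whose orbit equivalence
relation is `E`. -/
def IsGeneratedByFreeBorelAction (Γ : Type*) [Group Γ] {X : Type*} [MeasurableSpace X]
    (E : Setoid X) : Prop :=
  ∃ _ : MulAction Γ X,
    (∀ γ : Γ, Measurable fun x : X => γ • x) ∧
    (∀ (γ : Γ) (x : X), γ • x = x → γ = 1) ∧
    ∀ x y : X, E x y ↔ ∃ γ : Γ, γ • x = y

end BorelEq

/-! The proof turns the treeing into a Borel cocycle `ρ` from `E` to `Γ` that is injective on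
classes, then realises that cocycle by an action (`exists_injective_cocycle`,
`IsGeneratedByFreeBorelAction.of_cocycle`).

Since `Γ` contains a free group of rank `ℕ`, the edges of the treeing can be labelled by letters so
that edges leaving one vertex carry distinct letters and reversal inverts them. Multiplying labels
along walks is well defined by acyclicity, and a nontrivial path spells a nonempty reduced word, so
`ρ x y = 1` forces `x = y`.

On `Γ × X` identify `(g, x)` with `(g * ρ x y, y)` whenever `E x y`. Injectivity of `ρ` gives a
Borel transversal `Z`, and left multiplication on the first coordinate induces a free action of `Γ`
on `Z`, in which two points share an orbit exactly when their `X`-coordinates are `E`-equivalent.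
The space `X` embeds in `Z` by `x ↦ [1, x]`, while compressibility embeds `Z` in `X`, both within
`E`. Schröder–Bernstein then gives a Borel isomorphism within `E`, along which the action is
transported. Borelness throughout rests on Lusin–Novikov enumeration of the classes. -/

open Set Filter Topology MeasureTheory

/-! ### Lusin–Novikov uniformization, by a perfect-set construction -/

namespace LusinNovikov

/-- `A` is covered by countably many Borel graphs of partial functions from `X` to `Y`. -/
def GraphCoverable {X Y : Type*} [MeasurableSpace X] [MeasurableSpace Y] (A : Set (X × Y)) : Prop :=
  ∃ B : ℕ → Set (X × Y), (∀ n, MeasurableSet (B n)) ∧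
    (∀ n x y y', (x, y) ∈ B n → (x, y') ∈ B n → y = y') ∧ A ⊆ ⋃ n, B n

section Coverable

variable {X Y : Type*} [MeasurableSpace X] [MeasurableSpace Y]

theorem GraphCoverable.mono {A A' : Set (X × Y)} (h : A ⊆ A') (hA : GraphCoverable A') :
    GraphCoverable A := by
  obtain ⟨B, h1, h2, h3⟩ := hA
  exact ⟨B, h1, h2, h.trans h3⟩

theorem graphCoverable_empty : GraphCoverable (∅ : Set (X × Y)) :=
  ⟨fun _ => ∅, fun _ => MeasurableSet.empty, fun _ _ _ _ h => h.elim, empty_subset _⟩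

theorem GraphCoverable.iUnion {κ : Type*} [Countable κ] {A : κ → Set (X × Y)}
    (h : ∀ k, GraphCoverable (A k)) : GraphCoverable (⋃ k, A k) := by
  rcases isEmpty_or_nonempty κ with hκ | hκ
  · rw [iUnion_of_empty]; exact graphCoverable_empty
  choose B h1 h2 h3 using h
  obtain ⟨e, he⟩ := exists_surjective_nat (κ × ℕ)
  refine ⟨fun n => B (e n).1 (e n).2, fun n => h1 _ _, fun n => h2 _ _, ?_⟩
  refine iUnion_subset fun k => (h3 k).trans (iUnion_subset fun m => ?_)
  obtain ⟨n, hn⟩ := he (k, m)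
  refine subset_iUnion_of_subset n ?_
  simp [hn]

theorem GraphCoverable.union {A A' : Set (X × Y)} (h : GraphCoverable A) (h' : GraphCoverable A') :
    GraphCoverable (A ∪ A') := by
  rw [union_eq_iUnion]
  exact GraphCoverable.iUnion fun b => by cases b <;> simpa

/-- A family of sets is negligible if the base can be partitioned into Borel pieces so that each
member of the family is coverable over the corresponding piece. -/
def Negligible {ι : Type*} (A : ι → Set (X × Y)) : Prop :=
  ∃ Z : ι → Set X, (∀ i, MeasurableSet (Z i)) ∧ (∀ x, ∃ i, x ∈ Z i) ∧
    ∀ i, GraphCoverable (A i ∩ Prod.fst ⁻¹' Z i)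

/-- Pieces belonging to copies of the same set can be merged. Hence duplicating members of a
non-negligible family, as when each node of the tree gets two children, keeps it non-negligible. -/
theorem Negligible.of_comp {ι κ : Type*} [Finite κ] {A : ι → Set (X × Y)} {π : κ → ι}
    (h : Negligible (A ∘ π)) : Negligible A := by
  obtain ⟨Z, h1, h2, h3⟩ := h
  refine ⟨fun i => ⋃ k : {k // π k = i}, Z k, fun i => MeasurableSet.iUnion fun k => h1 _,
    fun x => ?_, fun i => ?_⟩
  · obtain ⟨k, hk⟩ := h2 x
    exact ⟨π k, mem_iUnion.2 ⟨⟨k, rfl⟩, hk⟩⟩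
  · rw [preimage_iUnion, inter_iUnion]
    refine GraphCoverable.iUnion fun k => ?_
    have := h3 k.1
    rwa [Function.comp_apply, k.2] at this

/-- Over the intersection of the pieces assigned to `i`, all parts of `A i` are coverable at once;
any other base point lies, for some `k`, in a piece of another index. Contrapositively, one part of
a countable cover of `A i` can replace it without losing non-negligibility. -/
theorem Negligible.of_iUnion {ι κ : Type*} [DecidableEq ι] [Countable κ] {A : ι → Set (X × Y)}
    (i : ι) (A' : κ → Set (X × Y)) (hA : A i ⊆ ⋃ k, A' k)
    (h : ∀ k, Negligible (Function.update A i (A' k))) : Negligible A := by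
  choose Z h1 h2 h3 using h
  refine ⟨fun j => if j = i then ⋂ k, Z k i else ⋃ k, Z k j, fun j => ?_, fun x => ?_, fun j => ?_⟩
  · dsimp only; split_ifs
    · exact MeasurableSet.iInter fun k => h1 _ _
    · exact MeasurableSet.iUnion fun k => h1 _ _
  · by_cases hx : x ∈ ⋂ k, Z k i
    · exact ⟨i, by simpa using hx⟩
    · simp only [mem_iInter, not_forall] at hx
      obtain ⟨k, hk⟩ := hx
      obtain ⟨j, hj⟩ := h2 k x
      have hji : j ≠ i := fun h => hk (h ▸ hj)
      refine ⟨j, ?_⟩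
      simp only [hji, if_false]
      exact mem_iUnion.2 ⟨k, hj⟩
  · by_cases hji : j = i
    · subst hji
      simp only [if_true]
      refine (GraphCoverable.iUnion fun k => h3 k j).mono ?_
      rintro p ⟨hp, hp'⟩
      obtain ⟨k, hk⟩ := mem_iUnion.1 (hA hp)
      refine mem_iUnion.2 ⟨k, by simpa using hk, ?_⟩
      exact mem_iInter.1 hp' k
    · simp only [hji, if_false]
      rw [preimage_iUnion, inter_iUnion]
      refine GraphCoverable.iUnion fun k => ?_
      have := h3 k j
      rwa [Function.update_of_ne hji] at this

theorem Negligible.of_empty {ι : Type*} {A : ι → Set (X × Y)} (i : ι) (h : A i = ∅) :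
    Negligible A := by
  classical
  refine ⟨fun j => if j = i then univ else ∅, fun j => ?_, fun x => ⟨i, by simp⟩, fun j => ?_⟩
  · dsimp only; split_ifs <;> simp
  · by_cases hj : j = i
    · subst hj; simp [h, graphCoverable_empty]
    · simp [hj, graphCoverable_empty]

theorem exists_shrink {f : (ℕ → ℕ) → X × Y} {ι : Type*} [DecidableEq ι]
    {C : ι → Set (ℕ → ℕ)} (hC : ∀ t, IsClosed (C t)) (hN : ¬ Negligible fun t => f '' C t)
    (t : ι) (n : ℕ) : ∃ C' ⊆ C t, IsClosed C' ∧ (∀ u ∈ C', ∀ v ∈ C', ∀ i < n, u i = v i) ∧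
      ¬ Negligible fun s => f '' (Function.update C t C' s) := by
  by_contra hcon
  push Not at hcon
  refine hN (Negligible.of_iUnion (κ := Fin n → ℕ) t
    (fun w => f '' (C t ∩ ⋂ i : Fin n, {u | u i = w i})) ?_ fun w => ?_)
  · rintro _ ⟨u, hu, rfl⟩
    exact mem_iUnion.2 ⟨fun i => u i, u, ⟨hu, mem_iInter.2 fun i => rfl⟩, rfl⟩
  · have := hcon (C t ∩ ⋂ i : Fin n, {u | u i = w i}) inter_subset_left
      ((hC t).inter (isClosed_iInter fun i => isClosed_eq (continuous_apply _) continuous_const))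
      (fun u hu v hv i hi => by
        have h1 := mem_iInter.1 hu.2 ⟨i, hi⟩
        have h2 := mem_iInter.1 hv.2 ⟨i, hi⟩
        simp only [mem_ofPred_eq] at h1 h2
        rw [h1, h2])
    convert this using 2 with s
    by_cases hs : s = t
    · subst hs; simp
    · simp [hs]

end Coverable

theorem analyticSet_image_of_isClosed {Z : Type*} [TopologicalSpace Z] {f : (ℕ → ℕ) → Z} (hf : Continuous f)
    {C : Set (ℕ → ℕ)} (hC : IsClosed C) : AnalyticSet (f '' C) :=
  hC.analyticSet.image_of_continuous hf

/-- Lusin separation of the two projections splits the base so that `A i` and `A j` are each empty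
over their own piece. -/
theorem Negligible.of_disjoint {X Y : Type*} [TopologicalSpace X] [PolishSpace X]
    [MeasurableSpace X] [BorelSpace X] [TopologicalSpace Y] [MeasurableSpace Y]
    {ι : Type*} {A : ι → Set (X × Y)} {i j : ι} (hij : i ≠ j)
    (hi : AnalyticSet (A i)) (hj : AnalyticSet (A j))
    (h : Disjoint (Prod.fst '' A i) (Prod.fst '' A j)) : Negligible A := by
  classical
  obtain ⟨C, hC1, hC2, hC3⟩ := (hi.image_of_continuous continuous_fst).measurablySeparable
    (hj.image_of_continuous continuous_fst) h
  refine ⟨fun k => if k = i then Cᶜ else if k = j then C else ∅, fun k => ?_, fun x => ?_,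
    fun k => ?_⟩
  · dsimp only; split_ifs
    exacts [hC3.compl, hC3, MeasurableSet.empty]
  · by_cases hx : x ∈ C
    · exact ⟨j, by simp [hij.symm, hx]⟩
    · exact ⟨i, by simp [hx]⟩
  · refine graphCoverable_empty.mono ?_
    rintro p ⟨hp, hp'⟩
    by_cases hk : k = i
    · subst hk
      simp only [if_true] at hp'
      exact hp' (hC1 ⟨p, hp, rfl⟩)
    by_cases hk' : k = j
    · subst hk'
      simp only [hk, if_true, if_false] at hp'
      exact hC2.le_bot ⟨⟨p, hp, rfl⟩, hp'⟩
    · simp [hk, hk'] at hp'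

variable {X Y : Type*} [TopologicalSpace X] [PolishSpace X] [MeasurableSpace X] [BorelSpace X]
  [TopologicalSpace Y] [PolishSpace Y] [MeasurableSpace Y] [BorelSpace Y]

theorem analyticSet_inter_measurableSet {α : Type*} [TopologicalSpace α] [PolishSpace α]
    [MeasurableSpace α] [BorelSpace α] {s t : Set α} (hs : AnalyticSet s) (ht : MeasurableSet t) :
    AnalyticSet (s ∩ t) := by
  rw [inter_eq_iInter]
  exact AnalyticSet.iInter fun b => by cases b <;> simp [hs, ht.analyticSet]

/-- Single-valuedness makes the projections of the parts of `A` over `U n` and `V n` disjoint, so a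
Borel `W n` separates them. The constraints given by all `W n` define a Borel graph containing `A`.
-/
theorem graphCoverable_of_singleValued {κ : Type*} [Countable κ] {U V : κ → Set Y}
    (hU : ∀ n, MeasurableSet (U n)) (hV : ∀ n, MeasurableSet (V n))
    (hUV : ∀ n, Disjoint (U n) (V n))
    (hsep : ∀ y y', y ≠ y' → ∃ n, y ∈ U n ∧ y' ∈ V n) {A : Set (X × Y)} (hA : AnalyticSet A)
    (h : ∀ x y y', (x, y) ∈ A → (x, y') ∈ A → y = y') : GraphCoverable A := by
  have key : ∀ n, MeasurablySeparable (Prod.fst '' (A ∩ Prod.snd ⁻¹' U n))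
      (Prod.fst '' (A ∩ Prod.snd ⁻¹' V n)) := by
    intro n
    refine AnalyticSet.measurablySeparable
      ((analyticSet_inter_measurableSet hA (measurable_snd (hU n))).image_of_continuous
        continuous_fst)
      ((analyticSet_inter_measurableSet hA (measurable_snd (hV n))).image_of_continuous
        continuous_fst) ?_
    rw [Set.disjoint_left]
    rintro _ ⟨⟨x, y⟩, ⟨h1, h2⟩, rfl⟩ ⟨⟨x', y'⟩, ⟨h3, h4⟩, h5⟩
    simp only at h5
    subst h5
    have := h _ _ _ h1 h3
    subst this
    exact (hUV n).le_bot ⟨h2, h4⟩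
  choose W h1 h2 h3 using key
  refine ⟨fun _ => ⋂ n, {p | (p.2 ∈ U n → p.1 ∈ W n) ∧ (p.2 ∈ V n → p.1 ∉ W n)}, fun _ => ?_,
    fun _ x y y' hy hy' => ?_, ?_⟩
  · refine MeasurableSet.iInter fun n => ?_
    refine MeasurableSet.inter ?_ ?_
    · exact MeasurableSet.imp (measurable_snd (hU n)) (measurable_fst (h3 n))
    · exact MeasurableSet.imp (measurable_snd (hV n)) (measurable_fst (h3 n)).compl
  · by_contra hne
    obtain ⟨n, hn, hn'⟩ := hsep y y' hne
    exact (mem_iInter.1 hy' n).2 hn' ((mem_iInter.1 hy n).1 hn)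
  · intro p hp
    refine mem_iUnion.2 ⟨0, mem_iInter.2 fun n => ⟨fun hu => h1 n ⟨p, ⟨hp, hu⟩, rfl⟩, fun hv hw => ?_⟩⟩
    exact (h2 n).le_bot ⟨⟨p, ⟨hp, hv⟩, rfl⟩, hw⟩

/-- Over the base points `Z₀` used by no other index, every separated pair in a section of `A i` has
a member already covered. What remains of `A i` there is single-valued, hence coverable too. -/
theorem Negligible.of_split {ι κ : Type*} [DecidableEq ι] [Countable ι] [Countable κ]
    {U V : κ → Set Y} (hU : ∀ n, MeasurableSet (U n)) (hV : ∀ n, MeasurableSet (V n))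
    (hUV : ∀ n, Disjoint (U n) (V n))
    (hsep : ∀ y y', y ≠ y' → ∃ n, y ∈ U n ∧ y' ∈ V n) {A : ι → Set (X × Y)} {i j : ι}
    (hij : i ≠ j) (hA : A i = A j) (hAi : AnalyticSet (A i))
    (h : ∀ n, Negligible (Function.update (Function.update A i (A i ∩ Prod.snd ⁻¹' U n)) j
      (A j ∩ Prod.snd ⁻¹' V n))) : Negligible A := by
  choose Z h1 h2 h3 using h
  set Z₀ : Set X := (⋃ k : {k : ι // k ≠ i ∧ k ≠ j}, ⋃ n, Z n k)ᶜ with hZ₀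
  have hZ₀m : MeasurableSet Z₀ :=
    (MeasurableSet.iUnion fun k => MeasurableSet.iUnion fun n => h1 _ _).compl
  have hcov : GraphCoverable (A i ∩ Prod.fst ⁻¹' Z₀) := by
    obtain ⟨B, hB1, hB2, hB3⟩ := (GraphCoverable.iUnion fun n => h3 n i).union
      (GraphCoverable.iUnion fun n => h3 n j)
    have hBm : MeasurableSet (⋃ n, B n) := MeasurableSet.iUnion hB1
    have hcov' : GraphCoverable ((A i ∩ Prod.fst ⁻¹' Z₀) ∩ (⋃ n, B n)ᶜ) := by
      refine graphCoverable_of_singleValued hU hV hUV hsep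
        (analyticSet_inter_measurableSet
          (analyticSet_inter_measurableSet hAi (measurable_fst hZ₀m)) hBm.compl) ?_
      rintro x y y' ⟨⟨hy, hx⟩, hyB⟩ ⟨⟨hy', -⟩, hyB'⟩
      by_contra hne
      obtain ⟨n, hn, hn'⟩ := hsep y y' hne
      obtain ⟨k, hk⟩ := h2 n x
      by_cases hki : k = i
      · subst hki
        refine hyB (hB3 (Or.inl (mem_iUnion.2 ⟨n, ?_, hk⟩)))
        rw [Function.update_of_ne hij, Function.update_self]
        exact ⟨hy, hn⟩
      by_cases hkj : k = j
      · subst hkj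
        refine hyB' (hB3 (Or.inr (mem_iUnion.2 ⟨n, ?_, hk⟩)))
        rw [Function.update_self]
        exact ⟨hA ▸ hy', hn'⟩
      · exact hx (mem_iUnion.2 ⟨⟨k, hki, hkj⟩, mem_iUnion.2 ⟨n, hk⟩⟩)
    refine (hcov'.union ⟨B, hB1, hB2, Subset.rfl⟩).mono fun p hp => ?_
    by_cases hpB : p ∈ ⋃ n, B n
    · exact Or.inr hpB
    · exact Or.inl ⟨hp, hpB⟩
  refine ⟨fun k => if k = i ∨ k = j then Z₀ else ⋃ n, Z n k, fun k => ?_, fun x => ?_, fun k => ?_⟩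
  · dsimp only; split_ifs
    exacts [hZ₀m, MeasurableSet.iUnion fun n => h1 _ _]
  · by_cases hx : x ∈ Z₀
    · exact ⟨i, by simpa using hx⟩
    · rw [hZ₀, notMem_compl_iff] at hx
      obtain ⟨⟨k, hki, hkj⟩, hk⟩ := mem_iUnion.1 hx
      exact ⟨k, by simpa [hki, hkj] using hk⟩
  · by_cases hki : k = i
    · subst hki; simpa using hcov
    by_cases hkj : k = j
    · subst hkj; simpa [hA] using hcov
    · simp only [hki, hkj, or_self, if_false]
      rw [preimage_iUnion, inter_iUnion]
      refine GraphCoverable.iUnion fun n => ?_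
      have := h3 n k
      rwa [Function.update_of_ne hkj, Function.update_of_ne hki] at this

theorem exists_countable_separating_closed (Y : Type*) [TopologicalSpace Y] [PolishSpace Y] :
    ∃ K : Set (Set Y × Set Y), K.Countable ∧ (∀ p ∈ K, IsClosed p.1 ∧ IsClosed p.2 ∧
      Disjoint p.1 p.2) ∧ ∀ y y', y ≠ y' → ∃ p ∈ K, y ∈ p.1 ∧ y' ∈ p.2 := by
  have hb := TopologicalSpace.isBasis_countableBasis Y
  have hc := TopologicalSpace.countable_countableBasis Y
  refine ⟨((fun p : Set Y × Set Y => (closure p.1, closure p.2)) ''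
    (TopologicalSpace.countableBasis Y ×ˢ TopologicalSpace.countableBasis Y)) ∩
      {p | Disjoint p.1 p.2}, ((hc.prod hc).image _).mono inter_subset_left, ?_, ?_⟩
  · rintro _ ⟨⟨p, -, rfl⟩, hp⟩
    exact ⟨isClosed_closure, isClosed_closure, hp⟩
  · intro y y' hne
    obtain ⟨u, hu, huo, v, hv, hvo, huv⟩ := exists_open_nhds_disjoint_closure hne
    obtain ⟨s, hs, hys, hsu⟩ := hb.exists_closure_subset (huo.mem_nhds hu)
    obtain ⟨t, ht, hyt, htv⟩ := hb.exists_closure_subset (hvo.mem_nhds hv)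
    refine ⟨(closure s, closure t), ⟨⟨(s, t), ⟨hs, ht⟩, rfl⟩, ?_⟩, subset_closure hys,
      subset_closure hyt⟩
    exact huv.mono (hsu.trans subset_closure) (htv.trans subset_closure)

/-- A stage of the construction of a perfect subset of a section: closed sets indexed by binary
strings of length `n`, with small diameters and jointly non-negligible images under `f`. -/
def IsStage (f : (ℕ → ℕ) → X × Y) (n : ℕ) (C : (Fin n → Bool) → Set (ℕ → ℕ)) : Prop :=
  (∀ t, IsClosed (C t)) ∧ (∀ t, ∀ u ∈ C t, ∀ v ∈ C t, ∀ i < n, u i = v i) ∧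
    ¬ Negligible fun t => f '' C t

theorem exists_split {f : (ℕ → ℕ) → X × Y} (hf : Continuous f) {ι : Type*} [DecidableEq ι]
    [Countable ι] {C : ι → Set (ℕ → ℕ)} (hC : ∀ t, IsClosed (C t))
    (hN : ¬ Negligible fun t => f '' C t) {i j : ι} (hij : i ≠ j) (hCij : C i = C j) :
    ∃ C₁ ⊆ C i, ∃ C₂ ⊆ C j, IsClosed C₁ ∧ IsClosed C₂ ∧
      (∀ u ∈ C₁, ∀ v ∈ C₂, (f u).2 ≠ (f v).2) ∧
      ¬ Negligible fun s => f '' (Function.update (Function.update C i C₁) j C₂ s) := by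
  obtain ⟨K, hK, hK1, hK2⟩ := exists_countable_separating_closed Y
  have : Countable K := hK
  by_contra hcon
  push Not at hcon
  refine hN (Negligible.of_split (κ := K) (U := fun p => p.1.1) (V := fun p => p.1.2)
    (fun p => (hK1 p p.2).1.measurableSet) (fun p => (hK1 p p.2).2.1.measurableSet)
    (fun p => (hK1 p p.2).2.2) (fun y y' h => ?_) hij (by simp only [hCij])
    (analyticSet_image_of_isClosed hf (hC i)) fun p => ?_)
  · obtain ⟨p, hp, h⟩ := hK2 y y' h
    exact ⟨⟨p, hp⟩, h⟩
  · have hsnd : Continuous fun u => (f u).2 := continuous_snd.comp hf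
    have := hcon (C i ∩ (fun u => (f u).2) ⁻¹' p.1.1) inter_subset_left
      (C j ∩ (fun u => (f u).2) ⁻¹' p.1.2) inter_subset_left
      ((hC i).inter ((hK1 p p.2).1.preimage hsnd)) ((hC j).inter ((hK1 p p.2).2.1.preimage hsnd))
      (fun u hu v hv huv => (hK1 p p.2).2.2.le_bot ⟨hu.2, by
        have := hv.2; simp only [mem_preimage, ← huv] at this; exact this⟩)
    convert this using 2 with s
    by_cases hs : s = j
    · subst hs
      simp only [Function.update_self]
      exact (image_inter_preimage f (C s) (Prod.snd ⁻¹' p.1.2)).symm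
    by_cases hs' : s = i
    · subst hs'
      simp only [Function.update_self, Function.update_of_ne hs]
      exact (image_inter_preimage f (C s) (Prod.snd ⁻¹' p.1.1)).symm
    · simp [hs, hs']

/-- Each node is first duplicated, then the strings of length `n` are treated one at a time: the two
copies are separated in `Y` and each is shrunk to agree on `n + 1` coordinates, keeping the whole
family non-negligible. -/
theorem exists_next_stage {f : (ℕ → ℕ) → X × Y} (hf : Continuous f) {n : ℕ}
    {C : (Fin n → Bool) → Set (ℕ → ℕ)} (hC : IsStage f n C) :
    ∃ C' : (Fin (n + 1) → Bool) → Set (ℕ → ℕ), IsStage f (n + 1) C' ∧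
      (∀ t, C' t ⊆ C (Fin.init t)) ∧
      ∀ t t', Fin.init t = Fin.init t' → t (Fin.last n) ≠ t' (Fin.last n) →
        ∀ u ∈ C' t, ∀ v ∈ C' t', (f u).2 ≠ (f v).2 := by
  classical
  obtain ⟨hC1, hC2, hC3⟩ := hC
  have key : ∀ s : Finset (Fin n → Bool), ∃ D : (Fin (n + 1) → Bool) → Set (ℕ → ℕ),
      (∀ t, IsClosed (D t)) ∧ (¬ Negligible fun t => f '' D t) ∧ (∀ t, D t ⊆ C (Fin.init t)) ∧
      (∀ t : Fin (n + 1) → Bool, Fin.init t ∉ s → D t = C (Fin.init t)) ∧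
      (∀ t : Fin (n + 1) → Bool, Fin.init t ∈ s → ∀ u ∈ D t, ∀ v ∈ D t, ∀ i < n + 1, u i = v i) ∧
      ∀ a ∈ s, ∀ u ∈ D (Fin.snoc a true), ∀ v ∈ D (Fin.snoc a false), (f u).2 ≠ (f v).2 := by
    intro s
    induction s using Finset.induction_on with
    | empty =>
      refine ⟨fun t => C (Fin.init t), fun t => hC1 _, fun h => hC3 ?_, fun t => Subset.rfl,
        fun t _ => rfl, by simp, by simp⟩
      exact Negligible.of_comp (π := fun t : Fin (n + 1) → Bool => (Fin.init t : Fin n → Bool)) h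
    | insert a s ha ih =>
      obtain ⟨D, h1, h2, h3, h4, h5, h6⟩ := ih
      set i : Fin (n + 1) → Bool := Fin.snoc a true with hi
      set j : Fin (n + 1) → Bool := Fin.snoc a false with hj
      have hia : (Fin.init i : Fin n → Bool) = a := Fin.init_snoc _ _
      have hja : (Fin.init j : Fin n → Bool) = a := Fin.init_snoc _ _
      have hij : i ≠ j := fun h => by
        have := congrFun h (Fin.last n)
        simp [hi, hj] at this
      have hall : ∀ t : Fin (n + 1) → Bool, Fin.init t = a → t = i ∨ t = j := by
        intro t ht
        rw [← Fin.snoc_init_self t, ht]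
        cases t (Fin.last n) <;> simp [hi, hj]
      have hDij : D i = D j := by
        rw [h4 i (by rwa [hia]), h4 j (by rwa [hja]), hia, hja]
      obtain ⟨C₁, hC₁, C₂, hC₂, h1c, h2c, h12, hN⟩ := exists_split hf h1 h2 hij hDij
      set D₁ := Function.update (Function.update D i C₁) j C₂ with hD₁
      have hD₁i : D₁ i = C₁ := by simp [hD₁, hij]
      have hD₁j : D₁ j = C₂ := by simp [hD₁]
      have hD₁o : ∀ t, t ≠ i → t ≠ j → D₁ t = D t := fun t h h' => by simp [hD₁, h, h']
      have hD₁c : ∀ t, IsClosed (D₁ t) := by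
        intro t
        by_cases hti : t = i
        · rw [hti, hD₁i]; exact h1c
        by_cases htj : t = j
        · rw [htj, hD₁j]; exact h2c
        rw [hD₁o t hti htj]; exact h1 t
      obtain ⟨C₃, hC₃, h3c, h3d, hN₃⟩ := exists_shrink hD₁c hN i (n + 1)
      set D₂ := Function.update D₁ i C₃ with hD₂
      have hD₂c : ∀ t, IsClosed (D₂ t) := by
        intro t
        by_cases hti : t = i
        · rw [hti, hD₂, Function.update_self]; exact h3c
        rw [hD₂, Function.update_of_ne hti]; exact hD₁c t
      obtain ⟨C₄, hC₄, h4c, h4d, hN₄⟩ := exists_shrink hD₂c hN₃ j (n + 1)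
      set D₃ := Function.update D₂ j C₄ with hD₃
      have hD₃j : D₃ j = C₄ := by simp [hD₃]
      have hD₃i : D₃ i = C₃ := by simp [hD₃, hD₂, hij]
      have hD₃o : ∀ t, t ≠ i → t ≠ j → D₃ t = D t := fun t h h' => by
        rw [hD₃, Function.update_of_ne h', hD₂, Function.update_of_ne h, hD₁o t h h']
      rw [hD₁i] at hC₃
      rw [hD₂, Function.update_of_ne hij.symm, hD₁j] at hC₄
      have hne : ∀ t : Fin (n + 1) → Bool, Fin.init t ≠ a → t ≠ i ∧ t ≠ j := fun t ht =>
        ⟨fun h => ht (h ▸ hia), fun h => ht (h ▸ hja)⟩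
      refine ⟨D₃, fun t => ?_, hN₄, fun t => ?_, fun t ht => ?_, fun t ht => ?_, fun b hb => ?_⟩
      · by_cases htj : t = j
        · rw [htj, hD₃j]; exact h4c
        rw [hD₃, Function.update_of_ne htj]; exact hD₂c t
      · by_cases hti : t = i
        · rw [hti, hD₃i]; exact (hC₃.trans hC₁).trans (h3 i)
        by_cases htj : t = j
        · rw [htj, hD₃j]; exact (hC₄.trans hC₂).trans (h3 j)
        rw [hD₃o t hti htj]; exact h3 t
      · rw [Finset.mem_insert, not_or] at ht
        obtain ⟨hti, htj⟩ := hne t ht.1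
        rw [hD₃o t hti htj]; exact h4 t ht.2
      · by_cases hti : t = i
        · rw [hti, hD₃i]; exact h3d
        by_cases htj : t = j
        · rw [htj, hD₃j]; exact h4d
        rw [hD₃o t hti htj]
        refine h5 t ((Finset.mem_insert.1 ht).resolve_left fun h => ?_)
        exact (hall t h).elim hti htj
      · by_cases hba : b = a
        · subst hba
          rw [← hi, ← hj, hD₃i, hD₃j]
          exact fun u hu v hv => h12 u (hC₃ hu) v (hC₄ hv)
        · have h1 := hne (Fin.snoc b true) (by rwa [Fin.init_snoc])
          have h2 := hne (Fin.snoc b false) (by rwa [Fin.init_snoc])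
          rw [hD₃o _ h1.1 h1.2, hD₃o _ h2.1 h2.2]
          exact h6 b ((Finset.mem_insert.1 hb).resolve_left hba)
  obtain ⟨D, h1, h2, h3, -, h5, h6⟩ := key Finset.univ
  refine ⟨D, ⟨h1, fun t => h5 t (Finset.mem_univ _), h2⟩, h3, fun t t' htt' hne u hu v hv => ?_⟩
  rw [← Fin.snoc_init_self t] at hu
  rw [← Fin.snoc_init_self t', ← htt'] at hv
  cases h : t (Fin.last n) <;> cases h' : t' (Fin.last n)
  · exact absurd (h.trans h'.symm) hne
  · rw [h] at hu; rw [h'] at hv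
    exact (h6 _ (Finset.mem_univ _) v hv u hu).symm
  · rw [h] at hu; rw [h'] at hv
    exact h6 _ (Finset.mem_univ _) u hu v hv
  · exact absurd (h.trans h'.symm) hne

theorem not_countable_nat_bool : ¬ Countable (ℕ → Bool) := by
  intro h
  obtain ⟨e, he⟩ := exists_surjective_nat (ℕ → Bool)
  obtain ⟨n, hn⟩ := he fun n => !(e n n)
  have := congrFun hn n
  simp at this

/-- Each branch of the tree of stages converges to a point. Non-negligibility forces the projections
of any two nodes of a level to meet, so in the limit all branches share a first coordinate, while
splitting keeps their second coordinates distinct. -/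
theorem exists_uncountable_section {f : (ℕ → ℕ) → X × Y} (hf : Continuous f)
    (h : ¬ GraphCoverable (range f)) : ∃ x, ¬ {y | (x, y) ∈ range f}.Countable := by
  have h0 : IsStage f 0 fun _ => univ := by
    refine ⟨fun _ => isClosed_univ, fun _ _ _ _ _ i hi => by omega, ?_⟩
    rintro ⟨Z, -, h2, h3⟩
    refine h ((h3 default).mono fun p hp => mem_inter (by simpa using hp) ?_)
    obtain ⟨i, hi⟩ := h2 p.1
    rwa [Subsingleton.elim default i]
  have hnext : ∀ n (S : {C // IsStage f n C}), ∃ S' : {C // IsStage f (n + 1) C},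
      (∀ t, S'.1 t ⊆ S.1 (Fin.init t)) ∧
      ∀ t t', Fin.init t = Fin.init t' → t (Fin.last n) ≠ t' (Fin.last n) →
        ∀ u ∈ S'.1 t, ∀ v ∈ S'.1 t', (f u).2 ≠ (f v).2 := by
    rintro n ⟨C, hC⟩
    obtain ⟨C', h1, h2⟩ := exists_next_stage hf hC
    exact ⟨⟨C', h1⟩, h2⟩
  choose next hsub hdisj using hnext
  let S : ∀ n, {C // IsStage f n C} := fun n => Nat.rec ⟨_, h0⟩ next n
  let T : (ℕ → Bool) → ℕ → Set (ℕ → ℕ) := fun b n => (S n).1 fun i => b i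
  have hTclosed : ∀ b n, IsClosed (T b n) := fun b n => (S n).2.1 _
  have hTdiam : ∀ b n, ∀ u ∈ T b n, ∀ v ∈ T b n, ∀ i < n, u i = v i := fun b n => (S n).2.2.1 _
  have hTsucc : ∀ b n, T b (n + 1) ⊆ T b n := fun b n => hsub n (S n) _
  have hTanti : ∀ b, Antitone (T b) := fun b => antitone_nat_of_succ_le (hTsucc b)
  have hTne : ∀ b n, (T b n).Nonempty := by
    intro b n
    rw [nonempty_iff_ne_empty]
    intro h
    exact (S n).2.2.2 (Negligible.of_empty (fun i : Fin n => b i) (by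
      change f '' T b n = ∅
      rw [h, image_empty]))
  choose p hp using hTne
  let u : (ℕ → Bool) → ℕ → ℕ := fun b i => p b (i + 1) i
  have hu_agree : ∀ b n, ∀ v ∈ T b n, ∀ i < n, v i = u b i := fun b n v hv i hi =>
    hTdiam b (i + 1) v (hTanti b (by omega : i + 1 ≤ n) hv) _ (hp b (i + 1)) i (by omega)
  have hlim : ∀ b (q : ℕ → ℕ → ℕ), (∀ n, q n ∈ T b n) → Tendsto q atTop (𝓝 (u b)) := by
    intro b q hq
    rw [tendsto_pi_nhds]
    intro i
    refine tendsto_const_nhds.congr' ?_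
    filter_upwards [eventually_gt_atTop i] with n hn
    exact (hu_agree b n _ (hq n) i hn).symm
  have hu_mem : ∀ b n, u b ∈ T b n := by
    intro b n
    refine (hTclosed b n).mem_of_tendsto (hlim b (p b) (hp b)) ?_
    filter_upwards [eventually_ge_atTop n] with m hm
    exact hTanti b hm (hp b m)
  have hfst : ∀ b b', (f (u b)).1 = (f (u b')).1 := by
    intro b b'
    have hq : ∀ n, ∃ q ∈ T b n, ∃ q' ∈ T b' n, (f q).1 = (f q').1 := by
      intro n
      by_cases hbb : (fun i : Fin n => b i) = fun i : Fin n => b' i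
      · have : T b n = T b' n := by simp only [T, hbb]
        exact ⟨p b n, hp b n, p b n, this ▸ hp b n, rfl⟩
      by_contra hcon
      push Not at hcon
      refine (S n).2.2.2 (Negligible.of_disjoint hbb
        (analyticSet_image_of_isClosed hf (hTclosed b n))
        (analyticSet_image_of_isClosed hf (hTclosed b' n)) ?_)
      rw [Set.disjoint_left]
      rintro _ ⟨_, ⟨v, hv, rfl⟩, rfl⟩ ⟨_, ⟨v', hv', rfl⟩, hvv⟩
      exact hcon v hv v' hv' hvv.symm
    choose q hq q' hq' hqq using hq
    have hc : Continuous fun v => (f v).1 := continuous_fst.comp hf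
    have h1 := (hc.tendsto (u b)).comp (hlim b q hq)
    have h2 := (hc.tendsto (u b')).comp (hlim b' q' hq')
    refine tendsto_nhds_unique h1 (h2.congr fun n => ?_)
    exact (hqq n).symm
  have hsnd : Function.Injective fun b => (f (u b)).2 := by
    intro b b' hbb
    by_contra hne
    have hex : ∃ n, b n ≠ b' n := Function.ne_iff.1 hne
    classical
    refine hdisj (Nat.find hex) (S _) (fun i => b i) (fun i => b' i) ?_ (Nat.find_spec hex)
      (u b) (hu_mem b (Nat.find hex + 1)) (u b')
      (hu_mem b' (Nat.find hex + 1)) hbb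
    funext i
    exact not_not.1 (Nat.find_min hex i.2)
  refine ⟨(f (u default)).1, fun hc => not_countable_nat_bool ?_⟩
  have := hc.preimage_of_injOn (f := fun b => (f (u b)).2) hsnd.injOn
  rw [← countable_univ_iff]
  refine this.mono fun b _ => ?_
  exact (⟨u b, Prod.ext (hfst b default) rfl⟩ : ((f (u default)).1, (f (u b)).2) ∈ range f)

/-- **Lusin–Novikov**: a Borel set with countable sections is covered by countably many Borel
graphs of partial functions. -/
theorem graphCoverable_of_countable_sections {R : Set (X × Y)} (hR : MeasurableSet R)
    (h : ∀ x, {y | (x, y) ∈ R}.Countable) : GraphCoverable R := by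
  have hRa := hR.analyticSet
  rw [AnalyticSet] at hRa
  rcases hRa with rfl | ⟨f, hf, rfl⟩
  · exact graphCoverable_empty
  · by_contra hcon
    obtain ⟨x, hx⟩ := exists_uncountable_section hf hcon
    exact hx (h x)

/-- A Borel reflexive relation with countable sections is enumerated by countably many Borel
functions. -/
theorem exists_measurable_enumeration {R : Set (X × X)} (hR : MeasurableSet R)
    (hrefl : ∀ x, (x, x) ∈ R) (h : ∀ x, {y | (x, y) ∈ R}.Countable) :
    ∃ r : ℕ → X → X, (∀ n, Measurable (r n)) ∧ ∀ x y, (x, y) ∈ R ↔ ∃ n, r n x = y := by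
  classical
  obtain ⟨B, hB1, hB2, hB3⟩ := graphCoverable_of_countable_sections hR h
  let D : ℕ → Set X := fun n => Prod.fst '' (B n ∩ R)
  have hD : ∀ n (S : Set X), MeasurableSet S →
      MeasurableSet (Prod.fst '' ((B n ∩ R) ∩ Prod.snd ⁻¹' S)) := fun n S hS =>
    (((hB1 n).inter hR).inter (measurable_snd hS)).image_of_measurable_injOn measurable_fst (by
      rintro ⟨x, y⟩ ⟨⟨hy, -⟩, -⟩ ⟨x', y'⟩ ⟨⟨hy', -⟩, -⟩ hxx
      simp only at hxx
      subst hxx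
      rw [hB2 n _ _ _ hy hy'])
  let r : ℕ → X → X := fun n x => if hx : ∃ y, (x, y) ∈ B n ∩ R then hx.choose else x
  have hr : ∀ n x y, (x, y) ∈ B n ∩ R → r n x = y := by
    intro n x y hxy
    have hx : ∃ y, (x, y) ∈ B n ∩ R := ⟨y, hxy⟩
    simp only [r, hx, dif_pos]
    exact hB2 n _ _ _ hx.choose_spec.1 hxy.1
  have hr' : ∀ n x, (¬ ∃ y, (x, y) ∈ B n ∩ R) → r n x = x := by
    intro n x hx
    simp only [r, hx, dif_neg, not_false_eq_true]
  refine ⟨r, fun n S hS => ?_, fun x y => ⟨fun hxy => ?_, ?_⟩⟩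
  · have : r n ⁻¹' S = (Prod.fst '' ((B n ∩ R) ∩ Prod.snd ⁻¹' S)) ∪
        (S \ Prod.fst '' ((B n ∩ R) ∩ Prod.snd ⁻¹' univ)) := by
      ext x
      by_cases hx : ∃ y, (x, y) ∈ B n ∩ R
      · obtain ⟨y, hy⟩ := hx
        rw [mem_preimage, hr n x y hy]
        constructor
        · intro hyS
          exact Or.inl ⟨(x, y), ⟨hy, hyS⟩, rfl⟩
        · rintro (⟨⟨x', y'⟩, ⟨hy', hS'⟩, rfl⟩ | ⟨-, hx⟩)
          · rwa [hB2 n _ _ _ hy.1 hy'.1]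
          · exact absurd ⟨(x, y), ⟨hy, mem_univ _⟩, rfl⟩ hx
      · rw [mem_preimage, hr' n x hx]
        constructor
        · intro hxS
          refine Or.inr ⟨hxS, ?_⟩
          rintro ⟨⟨x', y'⟩, ⟨hy', -⟩, rfl⟩
          exact hx ⟨y', hy'⟩
        · rintro (⟨⟨x', y'⟩, ⟨hy', hS'⟩, rfl⟩ | ⟨hxS, -⟩)
          · exact absurd ⟨y', hy'⟩ hx
          · exact hxS
    rw [this]
    exact (hD n S hS).union (hS.diff (hD n univ MeasurableSet.univ))
  · obtain ⟨n, hn⟩ := mem_iUnion.1 (hB3 hxy)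
    exact ⟨n, hr n x y ⟨hn, hxy⟩⟩
  · rintro ⟨n, rfl⟩
    by_cases hx : ∃ y, (x, y) ∈ B n ∩ R
    · obtain ⟨y, hy⟩ := hx
      rw [hr n x y hy]; exact hy.2
    · rw [hr' n x hx]; exact hrefl x

end LusinNovikov

/-! ### Free groups: reduced words and subgroups of infinite rank -/

namespace FreeGroup

theorem mk_ne_one_of_isReduced {α : Type*} {L : List (α × Bool)} (hL : IsReduced L)
    (hne : L ≠ []) : mk L ≠ 1 := by
  classical
  intro h
  have := congrArg toWord h
  rw [toWord_mk, hL.reduce_eq, toWord_one] at this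
  exact hne this

end FreeGroup

namespace IsFreeGroup

/-- An element commuting with all generators is central, since conjugation by it fixes them; with at
most one generator this makes the group abelian. -/
theorem exists_generators_ne {Γ : Type*} [Group Γ] [IsFreeGroup Γ]
    (h : ∃ a b : Γ, a * b ≠ b * a) : ∃ s t : Generators Γ, s ≠ t := by
  by_contra! hcon
  obtain ⟨a, b, hab⟩ := h
  have hconj : ∀ g : Γ, (∀ s, Commute g (of s)) → ∀ x, Commute g x := by
    intro g hg x
    have : (MulAut.conj g).toMonoidHom = MonoidHom.id Γ := ext_hom fun s => by
      simp [(hg s).eq]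
    have := DFunLike.congr_fun this x
    exact mul_inv_eq_iff_eq_mul.1 (by simpa using this)
  have h1 : ∀ s x, Commute (of s : Γ) x := fun s =>
    hconj _ fun t => by rw [hcon s t]
  exact hab (hconj a (fun s => (h1 s a).symm) b).eq

/-- A non-abelian free group contains a free group of countably infinite rank. -/
theorem exists_injective_freeGroup_nat {Γ : Type*} [Group Γ] [IsFreeGroup Γ]
    (h : ∃ a b : Γ, a * b ≠ b * a) : ∃ ψ : FreeGroup ℕ →* Γ, Function.Injective ψ := by
  classical
  obtain ⟨s, t, hst⟩ := exists_generators_ne h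
  let φ : Multiplicative ℤ →* MulAut (FreeGroup ℤ) :=
    zpowersHom _ (FreeGroup.freeGroupCongr (Equiv.addRight (1 : ℤ)))
  have hφ : ∀ n : ℕ, φ (Multiplicative.ofAdd 1 ^ n) (FreeGroup.of 0) = FreeGroup.of (n : ℤ) := by
    intro n
    induction n with
    | zero => simp
    | succ n ih =>
      rw [pow_succ', map_mul, MulAut.mul_apply, ih]
      simp [φ]
  -- Freeness of these conjugates is tested in the semidirect product where `ℤ` shifts the
  -- generators of `FreeGroup ℤ`: there `s` becomes the shift, `t` the generator `0`, and the `n`-th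
  -- conjugate the generator `n`.
  let ψ : FreeGroup ℕ →* Γ := FreeGroup.lift fun n => of s ^ n * of t * (of s ^ n)⁻¹
  let Φ : Γ →* FreeGroup ℤ ⋊[φ] Multiplicative ℤ := IsFreeGroup.lift fun u =>
    if u = s then SemidirectProduct.inr (Multiplicative.ofAdd 1)
    else if u = t then SemidirectProduct.inl (FreeGroup.of 0) else 1
  have hs : Φ (of s) = SemidirectProduct.inr (Multiplicative.ofAdd 1) := by simp [Φ]
  have ht : Φ (of t) = SemidirectProduct.inl (FreeGroup.of 0) := by simp [Φ, hst.symm]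
  have hcomp : Φ.comp ψ = SemidirectProduct.inl.comp (FreeGroup.map fun n : ℕ => (n : ℤ)) := by
    ext1 n
    simp only [MonoidHom.comp_apply, ψ, FreeGroup.lift_apply_of, FreeGroup.map.of, map_mul, map_inv,
      map_pow, hs, ht]
    rw [← hφ n, SemidirectProduct.inl_aut]
    simp
  refine ⟨ψ, Function.Injective.of_comp (f := Φ) ?_⟩
  rw [← MonoidHom.coe_comp, hcomp, MonoidHom.coe_comp]
  exact SemidirectProduct.inl_injective.comp (FreeGroup.map_injective Nat.cast_injective)

end IsFreeGroup

/-! ### Labels and words along walks in acyclic graphs -/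

namespace SimpleGraph

variable {V Γ : Type*} [Group Γ] {G : SimpleGraph V}

/-- The product of the labels of the steps of a walk. -/
def Walk.label (l : V → V → Γ) : ∀ {u v : V}, G.Walk u v → Γ
  | _, _, .nil => 1
  | u, _, .cons (v := v) _ p => l u v * p.label l

theorem Walk.label_append (l : V → V → Γ) {u v w : V} (p : G.Walk u v) (q : G.Walk v w) :
    (p.append q).label l = p.label l * q.label l := by
  induction p with
  | nil => simp [label]
  | cons h p ih => simp [label, ih, mul_assoc]

theorem IsAcyclic.label_bypass [DecidableEq V] (hG : G.IsAcyclic) {l : V → V → Γ}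
    (hl : ∀ u v, G.Adj u v → l v u = (l u v)⁻¹) {u v : V} (p : G.Walk u v) :
    p.bypass.label l = p.label l := by
  induction p with
  | nil => rfl
  | @cons u v w h p ih =>
    simp only [Walk.bypass]
    split_ifs with hs
    -- By uniqueness of paths the excised loop only crosses the edge from `u` to `v` and back, so
    -- its label cancels.
    · have hpath : p.bypass.takeUntil u hs = Walk.cons h.symm Walk.nil := by
        have := hG.subsingleton_path v u
        have h1 := (p.bypass_isPath).takeUntil hs
        have h2 : (Walk.cons h.symm Walk.nil : G.Walk v u).IsPath := by
          simp [Walk.cons_isPath_iff, h.ne.symm]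
        exact congrArg Subtype.val (Subsingleton.elim (⟨_, h1⟩ : G.Path v u) ⟨_, h2⟩)
      have := congrArg (Walk.label l) (p.bypass.take_spec hs)
      rw [Walk.label_append, hpath, ih] at this
      simp only [Walk.label, mul_one, hl u v h] at this
      simp only [Walk.label, ← this, mul_inv_cancel_left]
    · simp only [Walk.label, ih]

theorem IsAcyclic.label_eq (hG : G.IsAcyclic) {l : V → V → Γ}
    (hl : ∀ u v, G.Adj u v → l v u = (l u v)⁻¹) {u v : V} (p q : G.Walk u v) :
    p.label l = q.label l := by
  classical
  have := hG.subsingleton_path u v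
  rw [← hG.label_bypass hl p, ← hG.label_bypass hl q]
  exact congrArg (fun r : G.Path u v => r.1.label l) (Subsingleton.elim p.toPath q.toPath)

/-- The word spelled by the letters of the steps of a walk. -/
def Walk.word {α : Type*} (c : V → V → α) : ∀ {u v : V}, G.Walk u v → List α
  | _, _, .nil => []
  | u, _, .cons (v := v) _ p => c u v :: p.word c

theorem Walk.label_eq_mk_word {α : Type*} (c : V → V → α × Bool) {u v : V} (p : G.Walk u v) :
    p.label (fun x y => FreeGroup.mk [c x y]) = FreeGroup.mk (p.word c) := by
  induction p with
  | nil => rfl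
  | cons h p ih => rw [label, ih, word, FreeGroup.mul_mk]; rfl

/-- Cancellation of adjacent letters would, by injectivity of letters at a vertex, make the path
return at once along the edge just crossed. -/
theorem Walk.IsPath.isReduced_word {α : Type*} {c : V → V → α × Bool}
    (hc : ∀ u v, G.Adj u v → c v u = ((c u v).1, !(c u v).2))
    (hinj : ∀ u v w, G.Adj v u → G.Adj v w → c v u = c v w → u = w) {u v : V} {p : G.Walk u v}
    (hp : p.IsPath) : FreeGroup.IsReduced (p.word c) := by
  induction p with
  | nil => exact FreeGroup.IsReduced.nil
  | @cons u v w h p ih =>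
    cases p with
    | nil => exact FreeGroup.IsReduced.singleton
    | @cons _ x _ h' p =>
      simp only [word]
      rw [FreeGroup.isReduced_cons_cons]
      refine ⟨fun h1 => ?_, ih hp.of_cons⟩
      by_contra h2
      have hux : u = x := hinj u v x h.symm h' (by
        rw [hc u v h]
        refine Prod.ext h1 ?_
        simp only
        revert h2
        cases (c u v).2 <;> cases (c v x).2 <;> simp)
      subst hux
      rw [cons_isPath_iff] at hp
      exact hp.2 (by simp)

end SimpleGraph

/-! ### The cocycle of a treeing -/

namespace BorelEq

theorem IsGraphing.reachable_iff {X : Type*} {G : SimpleGraph X} {E : Setoid X}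
    (h : IsGraphing G E) {x y : X} : G.Reachable x y ↔ E x y := by
  subst h
  constructor
  · rintro ⟨p⟩
    induction p with
    | nil => exact Relation.EqvGen.refl _
    | cons h p ih => exact Relation.EqvGen.trans _ _ _ (Relation.EqvGen.rel _ _ h) ih
  · intro h
    change Relation.EqvGen G.Adj x y at h
    induction h with
    | rel x y h => exact h.reachable
    | refl x => exact SimpleGraph.Reachable.refl x
    | symm x y _ ih => exact ih.symm
    | trans x y z _ _ ih ih' => exact ih.trans ih'

/-- An enumeration of the classes of `E` by countably many Borel functions. -/
theorem IsCountableBorel.exists_enumeration {X : Type*} [TopologicalSpace X] [PolishSpace X]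
    [MeasurableSpace X] [BorelSpace X] {E : Setoid X} (hE : IsCountableBorel E) :
    ∃ r : ℕ → X → X, (∀ n, Measurable (r n)) ∧ ∀ x y, E x y ↔ ∃ n, r n x = y :=
  LusinNovikov.exists_measurable_enumeration hE.measurableSet (fun x => E.refl x)
    hE.countable_class

theorem exists_measurable_index {X : Type*} [MeasurableSpace X] [MeasurableEq X]
    {E : Setoid X} (hE : MeasurableSet {p : X × X | E p.1 p.2}) {r : ℕ → X → X}
    (hr : ∀ n, Measurable (r n)) (hrE : ∀ x y, E x y ↔ ∃ n, r n x = y) :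
    ∃ N : X × X → ℕ, Measurable N ∧ ∀ x y, E x y → r (N (x, y)) x = y := by
  classical
  -- The second alternative makes the search end, at `0`, on inequivalent pairs.
  have hp : ∀ p : X × X, ∃ n, r n p.1 = p.2 ∨ ¬ E p.1 p.2 := by
    intro p
    by_cases h : E p.1 p.2
    · obtain ⟨n, hn⟩ := (hrE _ _).1 h
      exact ⟨n, Or.inl hn⟩
    · exact ⟨0, Or.inr h⟩
  refine ⟨fun p => Nat.find (hp p), measurable_find hp fun k => ?_, fun x y h => ?_⟩
  · exact (measurableSet_eq_fun ((hr k).comp measurable_fst) measurable_snd).union hE.compl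
  · exact (Nat.find_spec (hp (x, y))).resolve_right (not_not.2 h)

/-- A Borel labelling of the pairs of equivalent points by letters of a free group, so that
reversing a pair inverts its letter and distinct pairs with the same source have distinct
letters. -/
theorem exists_measurable_letters {X : Type*} [MeasurableSpace X] [StandardBorelSpace X]
    {E : Setoid X} (hE : MeasurableSet {p : X × X | E p.1 p.2}) {r : ℕ → X → X}
    (hr : ∀ n, Measurable (r n)) (hrE : ∀ x y, E x y ↔ ∃ n, r n x = y) :
    ∃ c : X → X → ℕ × Bool, Measurable (fun p : X × X => c p.1 p.2) ∧
      (∀ x y, x ≠ y → c y x = ((c x y).1, !(c x y).2)) ∧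
      ∀ x y z, E y x → E y z → c y x = c y z → x = z := by
  classical
  obtain ⟨N, hN, hNr⟩ := exists_measurable_index hE hr hrE
  obtain ⟨f, hf⟩ := MeasureTheory.exists_measurableEmbedding_real X
  have hNs : Measurable fun p : X × X => N (p.2, p.1) := hN.comp measurable_swap
  -- The letter codes the indices in both directions, ordered through the embedding in `ℝ`; the sign
  -- records orientation. Letter and source thus determine the index of the target.
  refine ⟨fun x y => if f x < f y then (Nat.pair (N (x, y)) (N (y, x)), true)
    else (Nat.pair (N (y, x)) (N (x, y)), false), ?_, fun x y hxy => ?_, fun x y z hx hz h => ?_⟩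
  · refine Measurable.ite (measurableSet_lt (hf.measurable.comp measurable_fst)
      (hf.measurable.comp measurable_snd)) ?_ ?_
    · exact ((measurable_of_countable fun q : ℕ × ℕ => Nat.pair q.1 q.2).comp
        (hN.prodMk hNs)).prodMk measurable_const
    · exact ((measurable_of_countable fun q : ℕ × ℕ => Nat.pair q.1 q.2).comp
        (hNs.prodMk hN)).prodMk measurable_const
  · rcases lt_or_gt_of_ne (hf.injective.ne hxy) with h | h
    · simp [h, h.not_gt]
    · simp [h, h.not_gt]
  · have hN' : N (y, x) = N (y, z) := by
      dsimp only at h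
      split_ifs at h <;> simp_all [Nat.pair_eq_pair]
    rw [← hNr y x hx, hN', hNr y z hz]

/-- By induction on length: the first step goes to some `r n x` with some label `d`, so the
existential over walks becomes a countable union. -/
theorem measurableSet_walk_label {X F : Type*} [MeasurableSpace X] [StandardBorelSpace X]
    [Group F] [Countable F] {G : SimpleGraph X} (hG : MeasurableSet {p : X × X | G.Adj p.1 p.2})
    {r : ℕ → X → X} (hr : ∀ n, Measurable (r n)) (hrG : ∀ x y, G.Adj x y → ∃ n, r n x = y)
    {l : X → X → F} (hl : ∀ g, MeasurableSet {p : X × X | l p.1 p.2 = g}) (g : F) :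
    MeasurableSet {p : X × X | ∃ w : G.Walk p.1 p.2, w.label l = g} := by
  have key : ∀ (k : ℕ) (g : F),
      MeasurableSet {p : X × X | ∃ w : G.Walk p.1 p.2, w.length = k ∧ w.label l = g} := by
    intro k
    induction k with
    | zero =>
      intro g
      by_cases hg : g = 1
      · convert measurableSet_eq_fun (measurable_fst (α := X) (β := X)) measurable_snd using 1
        ext ⟨x, y⟩
        constructor
        · rintro ⟨w, hw, -⟩
          exact SimpleGraph.Walk.eq_of_length_eq_zero hw
        · intro h
          change x = y at h
          subst h
          exact ⟨SimpleGraph.Walk.nil, rfl, hg.symm⟩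
      · convert MeasurableSet.empty
        ext ⟨x, y⟩
        refine iff_of_false ?_ id
        rintro ⟨w, hw, hw'⟩
        cases w with
        | nil => exact hg hw'.symm
        | cons h w => simp at hw
    | succ k ih =>
      intro g
      have hstep : ∀ n, Measurable fun p : X × X => (p.1, r n p.1) := fun n =>
        measurable_fst.prodMk ((hr n).comp measurable_fst)
      have hrest : ∀ n, Measurable fun p : X × X => (r n p.1, p.2) := fun n =>
        ((hr n).comp measurable_fst).prodMk measurable_snd
      have : {p : X × X | ∃ w : G.Walk p.1 p.2, w.length = k + 1 ∧ w.label l = g} =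
          ⋃ (n : ℕ) (d : F), ((fun p : X × X => (p.1, r n p.1)) ⁻¹' {p | G.Adj p.1 p.2} ∩
            (fun p : X × X => (p.1, r n p.1)) ⁻¹' {p | l p.1 p.2 = d}) ∩
            (fun p : X × X => (r n p.1, p.2)) ⁻¹'
              {p | ∃ w : G.Walk p.1 p.2, w.length = k ∧ w.label l = d⁻¹ * g} := by
        ext ⟨x, y⟩
        simp only [mem_iUnion]
        constructor
        · rintro ⟨w, hw, hw'⟩
          cases w with
          | nil => simp at hw
          | @cons _ z _ h w =>
            obtain ⟨n, hn⟩ := hrG x z h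
            subst hn
            refine ⟨n, l x (r n x), ⟨h, rfl⟩, w, by simpa using hw, ?_⟩
            rw [← hw', SimpleGraph.Walk.label, inv_mul_cancel_left]
        · rintro ⟨n, d, ⟨h, rfl⟩, w, hw, hw'⟩
          refine ⟨SimpleGraph.Walk.cons h w, by simpa using hw, ?_⟩
          rw [SimpleGraph.Walk.label, hw']
          simp
      rw [this]
      exact MeasurableSet.iUnion fun n => MeasurableSet.iUnion fun d =>
        ((hstep n hG).inter (hstep n (hl d))).inter (hrest n (ih _))
  convert MeasurableSet.iUnion fun k => key k g using 1
  ext p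
  simp only [mem_iUnion]
  exact ⟨fun ⟨w, hw⟩ => ⟨w.length, w, rfl, hw⟩, fun ⟨_, w, _, hw⟩ => ⟨w, hw⟩⟩

/-- A treeable countable Borel equivalence relation has a Borel cocycle into every non-abelian free
group which is injective on classes. -/
theorem exists_injective_cocycle {X : Type*} [TopologicalSpace X] [PolishSpace X]
    [MeasurableSpace X] [BorelSpace X] {E : Setoid X} (hE : IsCountableBorel E)
    (htree : IsTreeable E) {Γ : Type*} [Group Γ] [IsFreeGroup Γ]
    (hΓ : ∃ a b : Γ, a * b ≠ b * a) :
    ∃ ρ : X → X → Γ, (∀ g, MeasurableSet {p : X × X | E p.1 p.2 ∧ ρ p.1 p.2 = g}) ∧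
      (∀ x y z, E x y → E y z → ρ x z = ρ x y * ρ y z) ∧
      ∀ x y, E x y → ρ x y = 1 → x = y := by
  classical
  obtain ⟨r, hr, hrE⟩ := hE.exists_enumeration
  obtain ⟨G, hGm, hGE, hG⟩ := htree
  obtain ⟨ψ, hψ⟩ := IsFreeGroup.exists_injective_freeGroup_nat hΓ
  obtain ⟨c, hcm, hc, hcinj⟩ := exists_measurable_letters hE.measurableSet hr hrE
  have hadj : ∀ x y, G.Adj x y → E x y := fun x y h => hGE.reachable_iff.1 h.reachable
  let l : X → X → FreeGroup ℕ := fun x y => FreeGroup.mk [c x y]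
  have hl : ∀ x y, G.Adj x y → l y x = (l x y)⁻¹ := fun x y h => by
    simp [l, hc x y h.ne, FreeGroup.inv_mk, FreeGroup.invRev]
  have hlm : ∀ g, MeasurableSet {p : X × X | l p.1 p.2 = g} := fun g =>
    hcm (MeasurableSet.of_discrete (s := {a | FreeGroup.mk [a] = g}))
  let σ : X → X → FreeGroup ℕ := fun x y => if h : G.Reachable x y then h.some.label l else 1
  have hσ : ∀ x y (w : G.Walk x y), σ x y = w.label l := fun x y w => by
    have h : G.Reachable x y := ⟨w⟩
    simp only [σ, h, dif_pos]
    exact hG.label_eq hl _ _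
  have hσinj : ∀ x y, E x y → σ x y = 1 → x = y := by
    intro x y hxy h
    obtain ⟨w⟩ := hGE.reachable_iff.2 hxy
    rw [hσ x y w.bypass, SimpleGraph.Walk.label_eq_mk_word] at h
    have hred := (w.bypass_isPath).isReduced_word (fun u v h => hc u v h.ne)
      fun u v w h h' => hcinj u v w (hadj _ _ h) (hadj _ _ h')
    by_contra hne
    refine FreeGroup.mk_ne_one_of_isReduced hred ?_ h
    generalize w.bypass = q
    cases q with
    | nil => exact absurd rfl hne
    | cons => simp [SimpleGraph.Walk.word]
  have hσm : ∀ g, MeasurableSet {p : X × X | E p.1 p.2 ∧ σ p.1 p.2 = g} := by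
    intro g
    convert measurableSet_walk_label hGm hr (fun x y h => (hrE x y).1 (hadj x y h)) hlm g using 1
    ext ⟨x, y⟩
    constructor
    · rintro ⟨hxy, h⟩
      obtain ⟨w⟩ := hGE.reachable_iff.2 hxy
      exact ⟨w, (hσ x y w).symm.trans h⟩
    · rintro ⟨w, hw⟩
      exact ⟨hGE.reachable_iff.1 ⟨w⟩, (hσ x y w).trans hw⟩
  refine ⟨fun x y => ψ (σ x y), fun g => ?_, fun x y z hxy hyz => ?_, fun x y hxy h => ?_⟩
  · convert MeasurableSet.iUnion fun d : {d // ψ d = g} => hσm d using 1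
    ext p
    simp only [mem_iUnion]
    constructor
    · rintro ⟨h1, h2⟩
      exact ⟨⟨_, h2⟩, h1, rfl⟩
    · rintro ⟨⟨d, hd⟩, h1, h2⟩
      exact ⟨h1, h2.symm ▸ hd⟩
  · obtain ⟨w⟩ := hGE.reachable_iff.2 hxy
    obtain ⟨w'⟩ := hGE.reachable_iff.2 hyz
    simp only
    rw [hσ x y w, hσ y z w', hσ x z (w.append w'), SimpleGraph.Walk.label_append, map_mul]
  · exact hσinj x y hxy (hψ (h.trans (map_one ψ).symm))

end BorelEq

/-! ### Borel Schröder–Bernstein -/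

namespace MeasurableEmbedding

/-- The Borel Schröder–Bernstein theorem, with the information that the resulting isomorphism is
pieced together from the first embedding and the inverse of the second. -/
theorem exists_measurableEquiv {α β : Type*} [MeasurableSpace α] [StandardBorelSpace α]
    [MeasurableSpace β] [StandardBorelSpace β] {f : α → β} {g : β → α}
    (hf : MeasurableEmbedding f) (hg : MeasurableEmbedding g) :
    ∃ e : α ≃ᵐ β, ∀ x, e x = f x ∨ g (e x) = x := by
  classical
  -- These are the points whose backward orbit stops in `α`, outside the range of `g`; `f` is used
  -- on them and the inverse of `g` elsewhere.
  let A : Set α := ⋃ n, (g ∘ f)^[n] '' (range g)ᶜ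
  have hiter : ∀ n, MeasurableEmbedding (g ∘ f)^[n] := by
    intro n
    induction n with
    | zero => exact MeasurableEmbedding.id
    | succ n ih => rw [Function.iterate_succ']; exact (hg.comp hf).comp ih
  have hA : MeasurableSet A :=
    MeasurableSet.iUnion fun n => (hiter n).measurableSet_image' hg.measurableSet_range.compl
  have hA0 : ∀ x, x ∉ A → ∃ y, g y = x := by
    intro x hx
    by_contra h
    exact hx (mem_iUnion.2 ⟨0, x, h, rfl⟩)
  have hA1 : ∀ a ∈ A, g (f a) ∈ A := by
    intro a ha
    obtain ⟨n, z, hz, rfl⟩ := mem_iUnion.1 ha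
    exact mem_iUnion.2 ⟨n + 1, z, hz, Function.iterate_succ_apply' _ _ _⟩
  have hA2 : ∀ y, g y ∈ A → ∃ a ∈ A, f a = y := by
    intro y hy
    obtain ⟨n, z, hz, h⟩ := mem_iUnion.1 hy
    cases n with
    | zero => exact absurd ⟨y, h.symm⟩ hz
    | succ n =>
      rw [Function.iterate_succ_apply'] at h
      exact ⟨_, mem_iUnion.2 ⟨n, z, hz, rfl⟩, hg.injective h⟩
  let h : α → β := fun x => if hx : x ∈ A then f x else (hA0 x hx).choose
  have h_pos : ∀ x ∈ A, h x = f x := fun x hx => by simp only [h, hx, dif_pos]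
  have h_neg : ∀ x, x ∉ A → g (h x) = x := fun x hx => by
    simp only [h, hx, dif_neg, not_false_eq_true]
    exact (hA0 x hx).choose_spec
  have hmeas : Measurable h := by
    intro S hS
    have : h ⁻¹' S = (A ∩ f ⁻¹' S) ∪ (Aᶜ ∩ g '' S) := by
      ext x
      by_cases hx : x ∈ A
      · simp [hx, h_pos x hx]
      · simp only [mem_preimage, mem_union, mem_inter_iff, hx, false_and, false_or,
          mem_compl_iff, not_false_eq_true, true_and]
        constructor
        · exact fun hS => ⟨h x, hS, h_neg x hx⟩
        · rintro ⟨y, hy, hyx⟩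
          rwa [hg.injective ((h_neg x hx).trans hyx.symm)]
    rw [this]
    exact (hA.inter (hf.measurable hS)).union (hA.compl.inter (hg.measurableSet_image' hS))
  have hmix : ∀ x ∈ A, ∀ x', x' ∉ A → h x ≠ h x' := by
    intro x hx x' hx' hxx
    rw [h_pos x hx] at hxx
    have := hA1 x hx
    rw [hxx, h_neg x' hx'] at this
    exact hx' this
  have hinj : Function.Injective h := by
    intro x x' hxx
    by_cases hx : x ∈ A <;> by_cases hx' : x' ∈ A
    · rw [h_pos x hx, h_pos x' hx'] at hxx
      exact hf.injective hxx
    · exact absurd hxx (hmix x hx x' hx')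
    · exact absurd hxx.symm (hmix x' hx' x hx)
    · rw [← h_neg x hx, ← h_neg x' hx', hxx]
  have hsurj : Function.Surjective h := by
    intro y
    by_cases hy : g y ∈ A
    · obtain ⟨a, ha, rfl⟩ := hA2 y hy
      exact ⟨a, h_pos a ha⟩
    · exact ⟨g y, hg.injective (h_neg _ hy)⟩
  refine ⟨⟨Equiv.ofBijective h ⟨hinj, hsurj⟩, hmeas, fun S hS => ?_⟩, fun x => ?_⟩
  · rw [← Equiv.image_eq_preimage_symm]
    exact (hmeas.measurableEmbedding hinj).measurableSet_image' hS
  · change h x = f x ∨ g (h x) = x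
    by_cases hx : x ∈ A
    · exact Or.inl (h_pos x hx)
    · exact Or.inr (h_neg x hx)

end MeasurableEmbedding

/-! ### Compressibility, the skew product and the action -/

namespace BorelEq

theorem iterate_injective_of_notMem_range {X : Type*} {φ : X → X} (hφ : Function.Injective φ)
    {a b : ℕ} {x y : X} (hx : x ∉ range φ) (hy : y ∉ range φ) (h : φ^[a] x = φ^[b] y) :
    a = b ∧ x = y := by
  induction a generalizing b with
  | zero =>
    cases b with
    | zero => exact ⟨rfl, h⟩
    | succ b => exact absurd ⟨_, ((Function.iterate_succ_apply' φ b y).symm.trans h.symm)⟩ hx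
  | succ a ih =>
    cases b with
    | zero => exact absurd ⟨_, ((Function.iterate_succ_apply' φ a x).symm.trans h)⟩ hy
    | succ b =>
      rw [Function.iterate_succ_apply', Function.iterate_succ_apply'] at h
      obtain ⟨rfl, rfl⟩ := ih (hφ h)
      exact ⟨rfl, rfl⟩

/-- A compressible countable Borel equivalence relation absorbs a countable set of indices. -/
theorem IsCompressible.exists_injection_prod_nat {X : Type*} [TopologicalSpace X] [PolishSpace X]
    [MeasurableSpace X] [BorelSpace X] {E : Setoid X} (hE : IsCountableBorel E)
    (hcomp : IsCompressible E) :
    ∃ j : X × ℕ → X, Measurable j ∧ Function.Injective j ∧ ∀ p, E p.1 (j p) := by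
  classical
  obtain ⟨φ, hφm, hφ, hφE, hφr⟩ := hcomp
  obtain ⟨r, hr, hrE⟩ := hE.exists_enumeration
  obtain ⟨N, hN, hNr⟩ := exists_measurable_index hE.measurableSet hr hrE
  have hex : ∀ x, ∃ n, r n x ∉ range φ := by
    intro x
    obtain ⟨y, hxy, hy⟩ := hφr x
    obtain ⟨n, rfl⟩ := (hrE x y).1 hxy
    exact ⟨n, hy⟩
  have hrange : MeasurableSet (range φ) := (hφm.measurableEmbedding hφ).measurableSet_range
  have hr' : Measurable fun p : ℕ × X => r p.1 p.2 := measurable_from_prod_countable_right hr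
  -- The forward `φ`-orbits of points outside the range of `φ` are injective and pairwise disjoint.
  -- As `c` may identify points, the exponent below also codes the index recovering `x` from `c x`.
  let c : X → X := fun x => r (Nat.find (hex x)) x
  have hc : Measurable c :=
    hr'.comp ((measurable_find hex fun k => hr k hrange.compl).prodMk measurable_id)
  have hcr : ∀ x, c x ∉ range φ := fun x => Nat.find_spec (hex x)
  have hcE : ∀ x, E x (c x) := fun x => (hrE _ _).2 ⟨_, rfl⟩
  have hiterE : ∀ n x, E x (φ^[n] x) := by
    intro n x
    induction n with
    | zero => exact E.refl x
    | succ n ih => rw [Function.iterate_succ_apply']; exact E.trans ih (hφE _)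
  have hiter : Measurable fun p : ℕ × X => φ^[p.1] p.2 :=
    measurable_from_prod_countable_right fun n => hφm.iterate n
  refine ⟨fun p => φ^[Nat.pair (N (c p.1, p.1)) p.2] (c p.1), ?_, ?_, fun p => ?_⟩
  · have h1 : Measurable fun p : X × ℕ => c p.1 := hc.comp measurable_fst
    have h2 : Measurable fun p : X × ℕ => Nat.pair (N (c p.1, p.1)) p.2 :=
      (measurable_of_countable fun q : ℕ × ℕ => Nat.pair q.1 q.2).comp
        ((hN.comp (h1.prodMk measurable_fst)).prodMk measurable_snd)
    exact hiter.comp (h2.prodMk h1)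
  · rintro ⟨x, n⟩ ⟨y, m⟩ h
    obtain ⟨h1, h2⟩ := iterate_injective_of_notMem_range hφ (hcr x) (hcr y) h
    simp only [Nat.pair_eq_pair] at h1
    obtain ⟨h1, rfl⟩ := h1
    have hx := hNr (c x) x (E.symm (hcE x))
    have hy := hNr (c y) y (E.symm (hcE y))
    rw [h1, h2, hy] at hx
    rw [hx]
  · exact E.trans (hcE _) (hiterE _ _)

/-- A Borel selector for the orbit equivalence relation of the skew product of `E` with a cocycle
which is injective on classes. -/
theorem exists_measurable_selector {X : Type*} [TopologicalSpace X] [PolishSpace X]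
    [MeasurableSpace X] [BorelSpace X] {E : Setoid X} (hE : IsCountableBorel E)
    {Γ : Type*} [Group Γ] [Countable Γ] [MeasurableSpace Γ] [DiscreteMeasurableSpace Γ]
    {ρ : X → X → Γ} (hρm : ∀ g, MeasurableSet {p : X × X | E p.1 p.2 ∧ ρ p.1 p.2 = g})
    (hρ : ∀ x y z, E x y → E y z → ρ x z = ρ x y * ρ y z)
    (hρ1 : ∀ x y, E x y → ρ x y = 1 → x = y) :
    ∃ s : Γ × X → Γ × X, Measurable s ∧ (∀ p, E p.2 (s p).2) ∧
      (∀ p, (s p).1 = p.1 * ρ p.2 (s p).2) ∧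
      ∀ p q, E p.2 q.2 → q.1 = p.1 * ρ p.2 q.2 → s p = s q := by
  classical
  obtain ⟨r, hr, hrE⟩ := hE.exists_enumeration
  obtain ⟨enc, henc⟩ := exists_injective_nat Γ
  have hrE' : ∀ n x, E x (r n x) := fun n x => (hrE _ _).2 ⟨n, rfl⟩
  have hv : ∀ n, Measurable fun x => ρ x (r n x) := by
    intro n
    refine measurable_to_countable' fun g => ?_
    convert (measurable_id.prodMk (hr n)) (hρm g) using 1
    ext x
    exact ⟨fun h => ⟨hrE' n x, h⟩, fun h => h.2⟩
  have hw : ∀ n, Measurable fun p : Γ × X => p.1 * ρ p.2 (r n p.2) := fun n =>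
    measurable_from_prod_countable_right fun g => (measurable_of_countable (g * ·)).comp (hv n)
  -- The selected point minimises the code of its group coordinate within its skew-product class; it
  -- is unique because injectivity of `ρ` lets a class contain at most one point with a given group
  -- coordinate.
  have hex : ∀ p : Γ × X, ∃ n, ∀ m, enc (p.1 * ρ p.2 (r n p.2)) ≤ enc (p.1 * ρ p.2 (r m p.2)) := by
    intro p
    have hne : (range fun n => enc (p.1 * ρ p.2 (r n p.2))).Nonempty := range_nonempty _
    obtain ⟨n, hn⟩ := Nat.sInf_mem hne
    exact ⟨n, fun m => hn.le.trans (Nat.sInf_le ⟨m, rfl⟩)⟩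
  have hk : Measurable fun p => Nat.find (hex p) := by
    refine measurable_find hex fun n => ?_
    have : {p : Γ × X | ∀ m, enc (p.1 * ρ p.2 (r n p.2)) ≤ enc (p.1 * ρ p.2 (r m p.2))} =
        ⋂ m, {p : Γ × X | enc (p.1 * ρ p.2 (r n p.2)) ≤ enc (p.1 * ρ p.2 (r m p.2))} := by
      ext p; simp
    rw [this]
    exact MeasurableSet.iInter fun m =>
      measurableSet_le ((measurable_of_countable enc).comp (hw n))
        ((measurable_of_countable enc).comp (hw m))
  have hr' : Measurable fun q : ℕ × X => r q.1 q.2 := measurable_from_prod_countable_right hr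
  have hw' : Measurable fun q : ℕ × (Γ × X) => q.2.1 * ρ q.2.2 (r q.1 q.2.2) :=
    measurable_from_prod_countable_right hw
  let s : Γ × X → Γ × X := fun p =>
    (p.1 * ρ p.2 (r (Nat.find (hex p)) p.2), r (Nat.find (hex p)) p.2)
  have hsE : ∀ p, E p.2 (s p).2 := fun p => hrE' _ _
  have hs1 : ∀ p, (s p).1 = p.1 * ρ p.2 (s p).2 := fun p => rfl
  have hmin : ∀ p z, E p.2 z → enc (s p).1 ≤ enc (p.1 * ρ p.2 z) := by
    intro p z hz
    obtain ⟨n, rfl⟩ := (hrE _ _).1 hz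
    exact Nat.find_spec (hex p) n
  refine ⟨s, (hw'.comp (hk.prodMk measurable_id)).prodMk (hr'.comp (hk.prodMk measurable_snd)),
    hsE, hs1, fun p q hpq hq => ?_⟩
  have hqs : (s q).1 = p.1 * ρ p.2 (s q).2 := by
    rw [hs1, hq, hρ _ _ _ hpq (hsE q), mul_assoc]
  have hps : (s p).1 = q.1 * ρ q.2 (s p).2 := by
    rw [hs1, hq, mul_assoc, ← hρ _ _ _ hpq (E.trans (E.symm hpq) (hsE p))]
  have h1 : (s p).1 = (s q).1 := by
    refine henc (le_antisymm ?_ ?_)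
    · rw [hqs]; exact hmin p _ (E.trans hpq (hsE q))
    · rw [hps]; exact hmin q _ (E.trans (E.symm hpq) (hsE p))
  have hE' : E (s p).2 (s q).2 := E.trans (E.symm (hsE p)) (E.trans hpq (hsE q))
  refine Prod.ext h1 (hρ1 _ _ hE' ?_)
  rw [hqs, hs1, hρ _ _ _ (hsE p) hE', ← mul_assoc] at h1
  exact left_eq_mul.1 h1

/-- A compressible countable Borel equivalence relation with a Borel cocycle into `Γ` which is
injective on classes is generated by a free Borel action of `Γ`. -/
theorem IsGeneratedByFreeBorelAction.of_cocycle {X : Type*} [TopologicalSpace X] [PolishSpace X]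
    [MeasurableSpace X] [BorelSpace X] {E : Setoid X} (hE : IsCountableBorel E)
    (hcomp : IsCompressible E) {Γ : Type*} [Group Γ] [Countable Γ]
    {ρ : X → X → Γ} (hρm : ∀ g, MeasurableSet {p : X × X | E p.1 p.2 ∧ ρ p.1 p.2 = g})
    (hρ : ∀ x y z, E x y → E y z → ρ x z = ρ x y * ρ y z)
    (hρ1 : ∀ x y, E x y → ρ x y = 1 → x = y) : IsGeneratedByFreeBorelAction Γ E := by
  let _ : MeasurableSpace Γ := ⊤
  have : DiscreteMeasurableSpace Γ := ⟨fun _ => trivial⟩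
  obtain ⟨s, hsm, hsE, hs1, hs⟩ := exists_measurable_selector hE hρm hρ hρ1
  obtain ⟨j, hjm, hj, hjE⟩ := IsCompressible.exists_injection_prod_nat hE hcomp
  obtain ⟨enc, henc⟩ := exists_injective_nat Γ
  have hρx : ∀ x, ρ x x = 1 := fun x => left_eq_mul.1 (hρ x x x (E.refl x) (E.refl x))
  have hss : ∀ p, s (s p) = s p := fun p => (hs p (s p) (hsE p) (hs1 p)).symm
  -- Left multiplication commutes with the right multiplications by `ρ`, hence descends to the
  -- quotient.
  have hsmul : ∀ (g : Γ) p, s (g * (s p).1, (s p).2) = s (g * p.1, p.2) := fun g p =>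
    (hs (g * p.1, p.2) (g * (s p).1, (s p).2) (hsE p) (by simp only [hs1, mul_assoc])).symm
  let Z : Set (Γ × X) := {p | s p = p}
  have hZ : MeasurableSet Z := measurableSet_eq_fun hsm measurable_id
  have : StandardBorelSpace Z := hZ.standardBorel
  let i : X → Z := fun x => ⟨s (1, x), hss _⟩
  have him : Measurable i := (hsm.comp (measurable_const.prodMk measurable_id)).subtype_mk
  have hi : Function.Injective i := by
    intro x x' h
    have h' : s (1, x) = s (1, x') := congrArg Subtype.val h
    have h1 := hs1 (1, x)
    have h2 := hs1 (1, x')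
    have hx := hsE (1, x)
    have hx' := hsE (1, x')
    simp only [one_mul, h'] at h1 h2 hx hx'
    refine hρ1 x x' (E.trans hx (E.symm hx')) ?_
    rw [hρ _ _ _ hx (E.symm hx'), ← h1, h2, ← hρ _ _ _ hx' (E.symm hx'), hρx]
  let k : Z → X := fun p => j (p.1.2, enc p.1.1)
  have hkm : Measurable k := hjm.comp ((measurable_snd.comp measurable_subtype_coe).prodMk
    ((measurable_of_countable enc).comp (measurable_fst.comp measurable_subtype_coe)))
  have hk : Function.Injective k := by
    intro p q h
    have := hj h
    simp only [Prod.mk.injEq] at this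
    exact Subtype.ext (Prod.ext (henc this.2) this.1)
  obtain ⟨e, he⟩ := (him.measurableEmbedding hi).exists_measurableEquiv (hkm.measurableEmbedding hk)
  -- Both embeddings stay within `E`, so the isomorphism pieced together from them does as well.
  have heE : ∀ x, E x (e x).1.2 := by
    intro x
    rcases he x with h | h
    · rw [h]; exact hsE (1, x)
    · have := hjE ((e x).1.2, enc (e x).1.1)
      change E _ (k (e x)) at this
      rw [h] at this
      exact E.symm this
  let act : Γ → X → X := fun g x => e.symm ⟨s (g * (e x).1.1, (e x).1.2), hss _⟩
  have hact : ∀ g x, (e (act g x)).1 = s (g * (e x).1.1, (e x).1.2) := fun g x => by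
    simp only [act, MeasurableEquiv.apply_symm_apply]
  have hsfix : ∀ x, s (e x).1 = (e x).1 := fun x => (e x).2
  have hext : ∀ x y, (e x).1 = (e y).1 → x = y := fun x y h => e.injective (Subtype.ext h)
  refine ⟨{ smul := act, one_smul := fun x => hext _ _ ?_, mul_smul := fun g h x => hext _ _ ?_ },
    fun g => ?_, fun g x h => ?_, fun x y => ⟨fun h => ?_, ?_⟩⟩
  · change (e (act (g * h) x)).1 = (e (act g (act h x))).1
    rw [hact, hact, hact, hsmul, mul_assoc]
  · change (e (act 1 x)).1 = _
    rw [hact, one_mul]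
    exact hsfix x
  · change Measurable (act g)
    have he1 : Measurable fun x => (e x).1 := measurable_subtype_coe.comp e.measurable
    exact e.symm.measurable.comp (Measurable.subtype_mk (hsm.comp
      (((measurable_of_countable (g * ·)).comp (measurable_fst.comp he1)).prodMk
        (measurable_snd.comp he1))))
  · change act g x = x at h
    have h1 := hact g x
    rw [h] at h1
    have h2 := hs1 (g * (e x).1.1, (e x).1.2)
    rw [← h1] at h2
    simp only [hρx, mul_one] at h2
    exact right_eq_mul.1 h2
  · have hE' : E (e x).1.2 (e y).1.2 := E.trans (E.symm (heE x)) (E.trans h (heE y))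
    -- This element solves `g * (e x).1.1 * ρ (e x).1.2 (e y).1.2 = (e y).1.1`, which puts the
    -- translate of `e x` in the skew-product class of `e y`.
    refine ⟨(e y).1.1 * (ρ (e x).1.2 (e y).1.2)⁻¹ * (e x).1.1⁻¹, hext _ _ ?_⟩
    refine (hact _ _).trans (Eq.trans ?_ (hsfix y))
    exact hs _ _ hE' (by simp)
  · rintro ⟨g, rfl⟩
    change E x (act g x)
    have h1 := hsE (g * (e x).1.1, (e x).1.2)
    rw [← hact] at h1
    exact E.trans (E.trans (heE x) h1) (E.symm (heE _))

end BorelEq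

theorem mainTheorem9 {X : Type*} [TopologicalSpace X] [PolishSpace X] [MeasurableSpace X]
    [BorelSpace X] (E : Setoid X) (hE : BorelEq.IsCountableBorel E)
    (hcomp : BorelEq.IsCompressible E) (htree : BorelEq.IsTreeable E)
    (Γ : Type*) [Group Γ] [Countable Γ] [IsFreeGroup Γ] (hΓ : ∃ a b : Γ, a * b ≠ b * a) :
    BorelEq.IsGeneratedByFreeBorelAction Γ E := by
  obtain ⟨ρ, h1, h2, h3⟩ := BorelEq.exists_injective_cocycle hE htree hΓ
  exact BorelEq.IsGeneratedByFreeBorelAction.of_cocycle hE hcomp h1 h2 h3
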